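/- A *singular holomorphic foliation by curves* $\mathcal F$ on $\mathbb{CP}^2$ consists of an analytic subvariety $E\subset\mathbb{CP}^2$ of codimension $>1$ and a holomorphic foliation by curves on $\mathbb{CP}^2\smallsetminus E$. The latter is a maximal atlas of charts $\varphi_i:U_i\to A_i\times B_i$ covering $\mathbb{CP}^2\smallsetminus E$, where each $\varphi_i$ is a biholomorphism from an open subset of $\mathbb{CP}^2\smallsetminus E$ onto a product of two open discs of $\mathbb C$, and where the second component of every change of charts $\varphi_i\circ\varphi_j^{-1}(z,w)$ has vanishing derivative with respect to $z$. A *flow box* is a biholomorphism $\varphi$ from an open subset of $\mathbb{CP}^2$ (possibly meeting $E$) onto a product $A\times B$ of two open discs which is compatible in this sense, in both directions, with all the charts of the atlas; its *plaques* are the sets $\varphi^{-1}(A\times\{w\})$, $w\in B$. The *singular points* of $\mathcal F$ are the points of $E$ that lie in no flow box (the non-removable singularities). The *leaf* $\mathcal L_p$ through $p$ is the set of points that can be joined to $p$ by a finite chain of successively intersecting plaques; for a singular point $p$ put $\mathcal L_p=\{p\}$. A set $S\subset\mathbb{CP}^2$ is *saturated* if $\mathcal L_p\subset S$ for every $p\in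 S$. A *minimal set* of $\mathcal F$ is a compact, saturated, non-empty subset of $\mathbb{CP}^2$ which is minimal, with respect to inclusion, among the subsets with these three properties; it is *non-trivial* if it is not of the form $\{p\}$ with $p$ a singular point of $\mathcal F$. **Theorem.** Every singular holomorphic foliation by curves on $\mathbb{CP}^2$ has at most one non-trivial minimal set: if $\mathcal M_1$ and $\mathcal M_2$ are non-trivial minimal sets of $\mathcal F$, then $\mathcal M_1=\mathcal M_2$. -/

import Mathlib

open scoped Manifold ContDiff LinearAlgebra.Projectivization

/-! ## The complex projective plane -/

/-- The complex projective plane: nonzero vectors of `ℂ³` up to nonzero scalars. -/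
abbrev CP2 : Type := ℙ ℂ (Fin 3 → ℂ)

namespace CP2

/-- The quotient topology from `ℂ³ ∖ {0}`. -/
noncomputable instance : TopologicalSpace CP2 :=
  TopologicalSpace.coinduced (Projectivization.mk' ℂ : {v : Fin 3 → ℂ // v ≠ 0} → CP2) inferInstance

/-- The open set `U_i = {[x₀, x₁, x₂] : x_i ≠ 0}`. -/
def affineOpen (i : Fin 3) : Set CP2 :=
  {p | p.rep i ≠ 0}

/-- The affine coordinates on `U_i`: divide by `x_i` and omit the `i`-th entry. -/
noncomputable def affineCoord (i : Fin 3) : CP2 → ℂ × ℂ :=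
  Projectivization.lift
    (fun v => (v.1 (i.succAbove 0) / v.1 i, v.1 (i.succAbove 1) / v.1 i))
    (by
      rintro ⟨a, ha⟩ ⟨b, hb⟩ t h
      simp only at h
      have ht : t ≠ 0 := by rintro rfl; simp at h; exact ha h
      subst h
      simp [mul_div_mul_left _ _ ht])

/-- The vector of `ℂ³` with `1` at position `i` and the two coordinates of `z` elsewhere. -/
noncomputable def affineVec (i : Fin 3) (z : ℂ × ℂ) : Fin 3 → ℂ :=
  i.insertNth (α := fun _ => ℂ) 1 ![z.1, z.2]

@[simp] lemma affineVec_self (i : Fin 3) (z : ℂ × ℂ) : affineVec i z i = 1 := by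
  simp [affineVec]

@[simp] lemma affineVec_zero (i : Fin 3) (z : ℂ × ℂ) :
    affineVec i z (i.succAbove 0) = z.1 := by
  simp [affineVec]

@[simp] lemma affineVec_one (i : Fin 3) (z : ℂ × ℂ) :
    affineVec i z (i.succAbove 1) = z.2 := by
  simp [affineVec]

lemma affineVec_ne_zero (i : Fin 3) (z : ℂ × ℂ) : affineVec i z ≠ 0 := by
  intro h
  simpa using congrFun h i

/-- The parametrization `ℂ² → U_i`; for instance `(x, y) ↦ [1, x, y]` for `i = 0`,
`(u, v) ↦ [u, 1, v]` for `i = 1` and `(r, s) ↦ [r, s, 1]` for `i = 2`. -/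
noncomputable def affineParam (i : Fin 3) (z : ℂ × ℂ) : CP2 :=
  Projectivization.mk ℂ (affineVec i z) (affineVec_ne_zero i z)

lemma continuous_entry (k : Fin 3) : Continuous (fun v : {v : Fin 3 → ℂ // v ≠ 0} => v.1 k) :=
  (continuous_apply k).comp continuous_subtype_val

lemma mk_mem_affineOpen (i : Fin 3) (v : Fin 3 → ℂ) (hv : v ≠ 0) :
    Projectivization.mk ℂ v hv ∈ affineOpen i ↔ v i ≠ 0 := by
  obtain ⟨a, ha⟩ := Projectivization.exists_smul_eq_mk_rep ℂ v hv
  simp only [affineOpen, Set.mem_ofPred_eq, ← ha, Pi.smul_apply, Units.smul_def, smul_eq_mul]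
  simp

lemma affineCoord_mk (i : Fin 3) (v : Fin 3 → ℂ) (hv : v ≠ 0) :
    affineCoord i (Projectivization.mk ℂ v hv)
      = (v (i.succAbove 0) / v i, v (i.succAbove 1) / v i) := rfl

lemma continuous_mk' :
    Continuous (Projectivization.mk' ℂ : {v : Fin 3 → ℂ // v ≠ 0} → CP2) :=
  continuous_coinduced_rng

lemma isOpen_affineOpen (i : Fin 3) : IsOpen (affineOpen i) := by
  refine isOpen_coinduced.2 ?_
  have : (Projectivization.mk' ℂ : {v : Fin 3 → ℂ // v ≠ 0} → CP2) ⁻¹' affineOpen i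
      = {v | v.1 i ≠ 0} := by
    ext v
    exact mk_mem_affineOpen i v.1 v.2
  rw [this]
  exact isOpen_ne_fun (continuous_entry i) continuous_const

lemma affineParam_affineCoord (i : Fin 3) (p : CP2) (hp : p ∈ affineOpen i) :
    affineParam i (affineCoord i p) = p := by
  induction p using Projectivization.ind with
  | h v hv =>
    rw [mk_mem_affineOpen] at hp
    rw [affineCoord_mk, affineParam, Projectivization.mk_eq_mk_iff']
    refine ⟨(v i)⁻¹, ?_⟩
    funext k
    rcases Fin.eq_self_or_eq_succAbove i k with rfl | ⟨j, rfl⟩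
    · simp [hp]
    · fin_cases j
      · simp [div_eq_inv_mul]
      · simp [div_eq_inv_mul]

lemma affineCoord_affineParam (i : Fin 3) (z : ℂ × ℂ) :
    affineCoord i (affineParam i z) = z := by
  simp [affineParam, affineCoord_mk]

lemma affineParam_mem (i : Fin 3) (z : ℂ × ℂ) : affineParam i z ∈ affineOpen i := by
  simp [affineParam, mk_mem_affineOpen]

lemma continuous_affineVec (i : Fin 3) : Continuous (affineVec i) := by
  refine continuous_pi fun k => ?_
  rcases Fin.eq_self_or_eq_succAbove i k with rfl | ⟨j, rfl⟩
  · simpa using continuous_const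
  · fin_cases j
    · simpa using continuous_fst
    · simpa using continuous_snd

lemma continuous_affineParam (i : Fin 3) : Continuous (affineParam i) :=
  continuous_mk'.comp ((continuous_affineVec i).subtype_mk (affineVec_ne_zero i))

lemma continuousOn_affineCoord (i : Fin 3) : ContinuousOn (affineCoord i) (affineOpen i) := by
  have hq : Topology.IsQuotientMap
      (Projectivization.mk' ℂ : {v : Fin 3 → ℂ // v ≠ 0} → CP2) :=
    ⟨⟨rfl⟩, Quotient.mk''_surjective⟩
  rw [hq.continuousOn_isOpen_iff (isOpen_affineOpen i)]
  have hs : ∀ v : {v : Fin 3 → ℂ // v ≠ 0},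
      v ∈ (Projectivization.mk' ℂ : {v : Fin 3 → ℂ // v ≠ 0} → CP2) ⁻¹' affineOpen i →
      v.1 i ≠ 0 := fun v hv => (mk_mem_affineOpen i v.1 v.2).1 hv
  change ContinuousOn (fun v : {v : Fin 3 → ℂ // v ≠ 0} =>
    (v.1 (i.succAbove 0) / v.1 i, v.1 (i.succAbove 1) / v.1 i)) _
  refine ContinuousOn.prodMk ?_ ?_
  · exact ContinuousOn.div (continuous_entry _).continuousOn (continuous_entry _).continuousOn hs
  · exact ContinuousOn.div (continuous_entry _).continuousOn (continuous_entry _).continuousOn hs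

/-- The affine chart `U_i → ℂ²`. -/
noncomputable def affineChart (i : Fin 3) : OpenPartialHomeomorph CP2 (ℂ × ℂ) where
  toFun := affineCoord i
  invFun := affineParam i
  source := affineOpen i
  target := Set.univ
  map_source' _ _ := Set.mem_univ _
  map_target' z _ := affineParam_mem i z
  left_inv' p hp := affineParam_affineCoord i p hp
  right_inv' z _ := affineCoord_affineParam i z
  open_source := isOpen_affineOpen i
  open_target := isOpen_univ
  continuousOn_toFun := continuousOn_affineCoord i
  continuousOn_invFun := (continuous_affineParam i).continuousOn

lemma exists_mem_affineOpen (p : CP2) : ∃ i, p ∈ affineOpen i :=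
  Function.ne_iff.1 p.rep_nonzero

/-- The atlas made of the three affine charts. -/
noncomputable instance : ChartedSpace (ℂ × ℂ) CP2 where
  atlas := Set.range affineChart
  chartAt p := affineChart (exists_mem_affineOpen p).choose
  mem_chart_source p := (exists_mem_affineOpen p).choose_spec
  chart_mem_atlas _ := ⟨_, rfl⟩

lemma contDiff_affineVec (i k : Fin 3) : ContDiff ℂ ω (fun z => affineVec i z k) := by
  rcases Fin.eq_self_or_eq_succAbove i k with rfl | ⟨j, rfl⟩
  · simpa using contDiff_const
  · fin_cases j
    · simpa using contDiff_fst
    · simpa using contDiff_snd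

/-- The changes of affine coordinates are holomorphic, so `CP2` is a complex surface. -/
instance : IsManifold 𝓘(ℂ, ℂ × ℂ) ω CP2 := by
  refine isManifold_of_contDiffOn _ _ _ ?_
  rintro _ _ ⟨i, rfl⟩ ⟨j, rfl⟩
  have hs : ∀ z : ℂ × ℂ, affineParam i z ∈ affineOpen j → affineVec i z j ≠ 0 :=
    fun z hz => (mk_mem_affineOpen j _ _).1 hz
  have h : ContDiffOn ℂ ω (fun z => affineCoord j (affineParam i z))
      {z | affineParam i z ∈ affineOpen j} := by
    change ContDiffOn ℂ ω (fun z => (affineVec i z (j.succAbove 0) / affineVec i z j,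
      affineVec i z (j.succAbove 1) / affineVec i z j)) _
    exact ((contDiff_affineVec i _).contDiffOn.div (contDiff_affineVec i _).contDiffOn hs).prodMk
      ((contDiff_affineVec i _).contDiffOn.div (contDiff_affineVec i _).contDiffOn hs)
  refine h.mono ?_
  rintro z ⟨hz, -⟩
  exact hz.2

end CP2

/-! ## Singular holomorphic foliations by curves on a complex surface

Throughout, a complex surface is a space `M` charted on `ℂ × ℂ` with holomorphic changes of
charts; a biholomorphism from an open subset of `M` onto an open subset of `ℂ × ℂ` is an element
of the maximal holomorphic atlas of `M`. -/

section Foliation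

variable {M : Type*} [TopologicalSpace M] [ChartedSpace (ℂ × ℂ) M]

/-- `E` is an analytic subvariety of `M`: every point of `M` has an open neighbourhood in which
`E` is the common zero set of finitely many holomorphic functions. -/
def IsAnalyticSubvariety (E : Set M) : Prop :=
  ∀ p : M, ∃ U : Set M, IsOpen U ∧ p ∈ U ∧ ∃ (k : ℕ) (f : Fin k → M → ℂ),
    (∀ j, MDifferentiableOn 𝓘(ℂ, ℂ × ℂ) 𝓘(ℂ, ℂ) (f j) U) ∧
    E ∩ U = {x ∈ U | ∀ j, f j x = 0}

/-- An analytic subvariety of a complex surface has codimension greater than one if and only if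
it has dimension zero at each of its points, that is, if all of its points are isolated. -/
def HasCodimGTOne (E : Set M) : Prop :=
  ∀ p ∈ E, ∃ U : Set M, IsOpen U ∧ E ∩ U = {p}

/-- A biholomorphism from an open subset of `M` onto a product `A × B` of two open discs
of `ℂ`. -/
def IsPolydiscChart (e : OpenPartialHomeomorph M (ℂ × ℂ)) : Prop :=
  e ∈ IsManifold.maximalAtlas 𝓘(ℂ, ℂ × ℂ) ω M ∧
    ∃ (a b : ℂ) (r s : ℝ), 0 < r ∧ 0 < s ∧ e.target = Metric.ball a r ×ˢ Metric.ball b s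

/-- The change of coordinates `e' ∘ e⁻¹`, defined on `e (e.source ∩ e'.source)`, has the form
`(z, w) ↦ (ψ (z, w), η w)`, in the sense that the derivative of its second component with respect
to `z` vanishes. -/
def PreservesHorizontal (e e' : OpenPartialHomeomorph M (ℂ × ℂ)) : Prop :=
  ∀ x ∈ (e.symm.trans e').source, fderiv ℂ (fun y => (e' (e.symm y)).2) x (1, 0) = 0

variable (M) in
/-- A singular holomorphic foliation by curves on a complex surface `M`: a holomorphic foliation
by curves on the complement of an analytic subvariety `E` of codimension greater than one, given
by its maximal atlas of foliation charts. -/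
structure SHFC where
  /-- The exceptional subvariety. -/
  E : Set M
  analytic : IsAnalyticSubvariety E
  codim : HasCodimGTOne E
  /-- The foliation charts on `M ∖ E`. -/
  atlas : Set (OpenPartialHomeomorph M (ℂ × ℂ))
  polydisc : ∀ e ∈ atlas, IsPolydiscChart e
  source_subset : ∀ e ∈ atlas, e.source ⊆ Eᶜ
  cover : ∀ p ∉ E, ∃ e ∈ atlas, p ∈ e.source
  compatible : ∀ e ∈ atlas, ∀ e' ∈ atlas, PreservesHorizontal e e'
  maximal : ∀ e, IsPolydiscChart e → e.source ⊆ Eᶜ →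
    (∀ e' ∈ atlas, PreservesHorizontal e e' ∧ PreservesHorizontal e' e) → e ∈ atlas

namespace SHFC

variable (F : SHFC M)

/-- A flow box: a polydisc chart of `M` compatible with all the foliation charts of `F`. Those
with domain in `M ∖ E` are exactly the foliation charts of `F`; the others are the compatible
charts around the removable points of `E`. -/
def IsFlowBox (e : OpenPartialHomeomorph M (ℂ × ℂ)) : Prop :=
  IsPolydiscChart e ∧ ∀ e' ∈ F.atlas, PreservesHorizontal e e' ∧ PreservesHorizontal e' e

/-- A point of `E` is a removable singularity if there is a chart around it which is compatible
with the foliation charts of `F`. -/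
def IsRemovable (p : M) : Prop :=
  p ∈ F.E ∧ ∃ e, F.IsFlowBox e ∧ p ∈ e.source

/-- The singular set: the non-removable points of `E`. -/
def sing : Set M :=
  {p | p ∈ F.E ∧ ¬ F.IsRemovable p}

/-- A plaque: the preimage of a horizontal disc `A × {w}` (with `w ∈ B`) under a flow box with
image `A × B`. -/
def IsPlaque (P : Set M) : Prop :=
  ∃ e, F.IsFlowBox e ∧ ∃ w ∈ Prod.snd '' e.target, P = {p ∈ e.source | (e p).2 = w}

/-- The leaf through `p`: all points which can be joined to `p` by a finite chain of plaques in
which consecutive plaques meet. A singular point lies in no plaque, so that its leaf is reduced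
to the point itself. -/
def leaf (p : M) : Set M :=
  {q | Relation.ReflTransGen (fun x y => ∃ P, F.IsPlaque P ∧ x ∈ P ∧ y ∈ P) p q}

/-- A set is saturated if it contains the leaf through each of its points. -/
def IsSaturated (S : Set M) : Prop :=
  ∀ p ∈ S, F.leaf p ⊆ S

/-- A minimal set: a compact saturated non-empty set which is minimal, with respect to inclusion,
among the sets with these three properties. -/
def IsMinimalSet (S : Set M) : Prop :=
  Minimal (fun T : Set M => IsCompact T ∧ F.IsSaturated T ∧ T.Nonempty) S

/-- A non-trivial minimal set: a minimal set which is not a singular point. -/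
def IsNontrivialMinimalSet (S : Set M) : Prop :=
  F.IsMinimalSet S ∧ ∀ p ∈ F.sing, S ≠ {p}

end SHFC

end Foliation

/-! The argument is Frankel's: positive curvature forbids two disjoint compact sets made of
holomorphic curves. Pick points `p`, `q` of the two minimal sets at the smallest Fubini–Study
distance, that is, with the largest `CP2.cosDist` (`CP2.exists_cosDist_max`). Neither is singular,
so through each passes an immersed holomorphic disc contained in its leaf, hence in its minimal set
(`SHFC.exists_analyticAt_lift_leaf`). Moving along the discs cannot bring the points closer.

The core is `norm_mul_norm_le_norm_inner_of_eventually_le`, for lifts `Z`, `W` of the discs to a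
space of dimension three. If the base vectors are orthogonal, a dimension count gives a
contradiction. Otherwise the lifts can be normalised so that both velocities are orthogonal to `Z 0`
and `W 0`; they then lie on one complex line, and the discs can be moved in parallel. Averaging the
second variation over the directions `1` and `i` cancels the accelerations, because the curves are
holomorphic (`second_variation_le`). What remains is equality in Cauchy–Schwarz, so `p = q`. Two
minimal sets with a common point are equal (`SHFC.IsMinimalSet.eq_of_inter_nonempty`). -/

open Filter Topology InnerProductSpace ComplexConjugate


/-! ### Second variation of the angle between two holomorphic curves. -/

section LocalAngle

variable {E : Type*} [NormedAddCommGroup E] [InnerProductSpace ℂ E]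

/-- Second order Taylor expansion with analytic remainder. -/
lemma AnalyticAt.exists_eq_add_smul_add_sq_smul {Z : ℂ → E} (hZ : AnalyticAt ℂ Z 0) :
    ∃ ζ : ℂ → E, AnalyticAt ℂ ζ 0 ∧ ∀ s, Z s = Z 0 + s • deriv Z 0 + s ^ 2 • ζ s := by
  have key : ∀ f : ℂ → E, AnalyticAt ℂ f 0 → AnalyticAt ℂ (dslope f 0) 0 := by
    rintro f ⟨p, hp⟩
    exact ⟨_, hp.has_fpower_series_dslope_fslope⟩
  -- The remainder is the divided difference taken twice at `0`.
  refine ⟨dslope (dslope Z 0) 0, key _ (key _ hZ), fun s => ?_⟩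
  have h1 := sub_smul_dslope Z 0 s
  have h2 := sub_smul_dslope (dslope Z 0) 0 s
  rw [dslope_same] at h2
  simp only [sub_zero] at h1 h2
  rw [pow_two, mul_smul, h2, smul_sub, h1]
  abel

/-- Along a real line of direction `u`, the squared norm of `a + s b + s² ζ(s)` with `a ⟂ b`
has no first order term. -/
lemma norm_sq_expansion {a b z : E} (hab : ⟪a, b⟫_ℂ = 0) (ε : ℝ) (u : ℂ) :
    ‖a + ((ε : ℂ) * u) • b + ((ε : ℂ) * u) ^ 2 • z‖ ^ 2 =
      ‖a‖ ^ 2 + ε ^ 2 * (‖u • b‖ ^ 2 + 2 * (u ^ 2 * ⟪a, z⟫_ℂ).re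
        + 2 * ε * (⟪u • b, u ^ 2 • z⟫_ℂ).re + ε ^ 2 * ‖u ^ 2 • z‖ ^ 2) := by
  have e1 : ((ε : ℂ) * u) • b = (ε : ℂ) • (u • b) := mul_smul _ _ _
  have e2 : ((ε : ℂ) * u) ^ 2 • z = ((ε ^ 2 : ℝ) : ℂ) • (u ^ 2 • z) := by
    rw [smul_smul]; push_cast; ring_nf
  have h1 := @norm_add_sq ℂ E _ _ _ (a + ((ε : ℂ) * u) • b) (((ε : ℂ) * u) ^ 2 • z)
  have h2 := @norm_add_sq ℂ E _ _ _ a (((ε : ℂ) * u) • b)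
  have i1 : ⟪a, ((ε : ℂ) * u) • b⟫_ℂ = 0 := by rw [inner_smul_right, hab, mul_zero]
  have i2 : ⟪a + ((ε : ℂ) * u) • b, ((ε : ℂ) * u) ^ 2 • z⟫_ℂ
      = ((ε ^ 2 : ℝ) : ℂ) * (u ^ 2 * ⟪a, z⟫_ℂ) + ((ε ^ 3 : ℝ) : ℂ) * ⟪u • b, u ^ 2 • z⟫_ℂ := by
    rw [inner_add_left, e1, e2, inner_smul_left, inner_smul_right a, inner_smul_right a z,
      inner_smul_right (u • b) (u ^ 2 • z), Complex.conj_ofReal]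
    push_cast; ring
  rw [h1, h2, i1, i2]
  have n1 : ‖((ε : ℂ) * u) • b‖ ^ 2 = ε ^ 2 * ‖u • b‖ ^ 2 := by
    rw [e1, norm_smul, mul_pow, Complex.norm_real, Real.norm_eq_abs, sq_abs]
  have n2 : ‖((ε : ℂ) * u) ^ 2 • z‖ ^ 2 = ε ^ 4 * ‖u ^ 2 • z‖ ^ 2 := by
    rw [e2, norm_smul, mul_pow, Complex.norm_real, Real.norm_eq_abs, sq_abs]; ring
  rw [n1, n2]
  simp only [RCLike.re_to_complex, Complex.add_re, Complex.re_ofReal_mul, Complex.zero_re]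
  ring

/-- Restrict the squared inequality to the real line `s = ε u`. Orthogonality removes the terms of
order `ε` and the constant terms agree, so dividing by `ε ^ 2` and letting `ε → 0` compares the
second order coefficients. -/
lemma two_mul_re_le_of_eventually {a b a' b' z z' : E} {ζ η : ℂ → E}
    (hζ : ContinuousAt ζ 0) (hη : ContinuousAt η 0)
    (hab : ⟪a, b⟫_ℂ = 0) (hab' : ⟪a', b'⟫_ℂ = 0)
    (hz : ζ 0 = z) (hz' : η 0 = z') (u : ℂ) (hu : ‖u‖ = 1)
    (h1 : ⟪a', b⟫_ℂ = 0) (h2 : ⟪a, b'⟫_ℂ = 0)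
    (h3 : ∀ᶠ s in 𝓝 (0 : ℂ), s ≠ 0 → ⟪a', ζ s⟫_ℂ = 0) (h4 : ∀ᶠ s in 𝓝 (0 : ℂ), s ≠ 0 → ⟪a, η s⟫_ℂ = 0)
    (hle : ∀ᶠ s in 𝓝 (0 : ℂ),
      ‖⟪a + s • b + s ^ 2 • ζ s, a' + s • b' + s ^ 2 • η s⟫_ℂ‖ * (‖a‖ * ‖a'‖)
        ≤ ‖⟪a, a'⟫_ℂ‖ * (‖a + s • b + s ^ 2 • ζ s‖ * ‖a' + s • b' + s ^ 2 • η s‖)) :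
    2 * (conj ⟪a, a'⟫_ℂ * ⟪b, b'⟫_ℂ).re * (‖a‖ ^ 2 * ‖a'‖ ^ 2)
      ≤ ‖⟪a, a'⟫_ℂ‖ ^ 2 *
        ((‖b‖ ^ 2 + 2 * (u ^ 2 * ⟪a, z⟫_ℂ).re) * ‖a'‖ ^ 2
          + (‖b'‖ ^ 2 + 2 * (u ^ 2 * ⟪a', z'⟫_ℂ).re) * ‖a‖ ^ 2) := by
  set c := ⟪a, a'⟫_ℂ with hc
  have hs : Tendsto (fun ε : ℝ => (ε : ℂ) * u) (𝓝 0) (𝓝 0) := by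
    have : Continuous (fun ε : ℝ => (ε : ℂ) * u) := by fun_prop
    simpa using this.tendsto 0
  have tζ : Tendsto (fun ε : ℝ => ζ ((ε : ℂ) * u)) (𝓝 0) (𝓝 z) := hz ▸ hζ.tendsto.comp hs
  have tη : Tendsto (fun ε : ℝ => η ((ε : ℂ) * u)) (𝓝 0) (𝓝 z') := hz' ▸ hη.tendsto.comp hs
  have tε : Tendsto (fun ε : ℝ => ε) (𝓝 0) (𝓝 0) := tendsto_id
  have tεC : Tendsto (fun ε : ℝ => (ε : ℂ)) (𝓝 0) (𝓝 0) := by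
    simpa using Complex.continuous_ofReal.tendsto 0
  -- the second order coefficients
  set N : ℝ → ℝ := fun ε => ‖u • b‖ ^ 2 + 2 * (u ^ 2 * ⟪a, ζ (ε * u)⟫_ℂ).re
        + 2 * ε * (⟪u • b, u ^ 2 • ζ (ε * u)⟫_ℂ).re + ε ^ 2 * ‖u ^ 2 • ζ (ε * u)‖ ^ 2 with hN
  set N' : ℝ → ℝ := fun ε => ‖u • b'‖ ^ 2 + 2 * (u ^ 2 * ⟪a', η (ε * u)⟫_ℂ).re
        + 2 * ε * (⟪u • b', u ^ 2 • η (ε * u)⟫_ℂ).re + ε ^ 2 * ‖u ^ 2 • η (ε * u)‖ ^ 2 with hN'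
  set P : ℝ → ℂ := fun ε => ⟪u • b + ((ε : ℂ) * u ^ 2) • ζ (ε * u),
      u • b' + ((ε : ℂ) * u ^ 2) • η (ε * u)⟫_ℂ with hP
  have tendN : ∀ (x y : E) (l : E) (θ : ℂ → E),
      Tendsto (fun ε : ℝ => θ ((ε : ℂ) * u)) (𝓝 0) (𝓝 l) →
      Tendsto (fun ε : ℝ => ‖u • y‖ ^ 2 + 2 * (u ^ 2 * ⟪x, θ (ε * u)⟫_ℂ).re
        + 2 * ε * (⟪u • y, u ^ 2 • θ (ε * u)⟫_ℂ).re + ε ^ 2 * ‖u ^ 2 • θ (ε * u)‖ ^ 2) (𝓝 0)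
        (𝓝 (‖y‖ ^ 2 + 2 * (u ^ 2 * ⟪x, l⟫_ℂ).re)) := by
    intro x y l θ tθ
    have t1 : Tendsto (fun ε : ℝ => (u ^ 2 * ⟪x, θ (ε * u)⟫_ℂ).re) (𝓝 0)
        (𝓝 (u ^ 2 * ⟪x, l⟫_ℂ).re) :=
      (Complex.continuous_re.tendsto _).comp ((tendsto_const_nhds.inner tθ).const_mul _)
    have t2 : Tendsto (fun ε : ℝ => (⟪u • y, u ^ 2 • θ (ε * u)⟫_ℂ).re) (𝓝 0)
        (𝓝 (⟪u • y, u ^ 2 • l⟫_ℂ).re) :=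
      (Complex.continuous_re.tendsto _).comp (tendsto_const_nhds.inner (tθ.const_smul _))
    have := (((t1.const_mul 2).const_add (‖u • y‖ ^ 2)).add ((tε.const_mul 2).mul t2)).add
      ((tε.pow 2).mul ((tθ.const_smul (u ^ 2)).norm.pow 2))
    simpa [norm_smul, hu] using this
  have tN : Tendsto N (𝓝 0) (𝓝 _) := tendN a b z ζ tζ
  have tN' : Tendsto N' (𝓝 0) (𝓝 _) := tendN a' b' z' η tη
  have tP : Tendsto P (𝓝 0) (𝓝 ⟪b, b'⟫_ℂ) := by
    have := (((tεC.mul_const (u ^ 2)).smul tζ).const_add (u • b)).inner (𝕜 := ℂ)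
      (((tεC.mul_const (u ^ 2)).smul tη).const_add (u • b'))
    have huu : conj u * u = 1 := by
      rw [← Complex.normSq_eq_conj_mul_self, Complex.normSq_eq_norm_sq, hu]; simp
    have e : ⟪u • b + ((0 : ℂ) * u ^ 2) • z, u • b' + ((0 : ℂ) * u ^ 2) • z'⟫_ℂ = ⟪b, b'⟫_ℂ := by
      rw [zero_mul, zero_smul, zero_smul, add_zero, add_zero, inner_smul_left, inner_smul_right,
        ← mul_assoc, huu, one_mul]
    rwa [e] at this
  have tL : Tendsto (fun ε : ℝ => (2 * (conj c * P ε).re + ε ^ 2 * ‖P ε‖ ^ 2) *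
      (‖a‖ ^ 2 * ‖a'‖ ^ 2)) (𝓝[≠] 0) (𝓝 (2 * (conj c * ⟪b, b'⟫_ℂ).re * (‖a‖ ^ 2 * ‖a'‖ ^ 2))) := by
    have := (((((Complex.continuous_re.tendsto _).comp (tP.const_mul (conj c))).const_mul 2).add
      ((tε.pow 2).mul (tP.norm.pow 2))).mul_const (‖a‖ ^ 2 * ‖a'‖ ^ 2)).mono_left
        (nhdsWithin_le_nhds (s := {0}ᶜ))
    simpa using this
  have tR : Tendsto (fun ε : ℝ => ‖c‖ ^ 2 *
      (N ε * ‖a'‖ ^ 2 + N' ε * ‖a‖ ^ 2 + ε ^ 2 * (N ε * N' ε))) (𝓝[≠] 0) (𝓝 (‖c‖ ^ 2 *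
        ((‖b‖ ^ 2 + 2 * (u ^ 2 * ⟪a, z⟫_ℂ).re) * ‖a'‖ ^ 2
          + (‖b'‖ ^ 2 + 2 * (u ^ 2 * ⟪a', z'⟫_ℂ).re) * ‖a‖ ^ 2))) := by
    have := ((((tN.mul_const (‖a'‖ ^ 2)).add (tN'.mul_const (‖a‖ ^ 2))).add
      ((tε.pow 2).mul (tN.mul tN'))).const_mul (‖c‖ ^ 2)).mono_left
        (nhdsWithin_le_nhds (s := {0}ᶜ))
    simpa only [ne_eq, OfNat.ofNat_ne_zero, not_false_eq_true, zero_pow, zero_mul, add_zero]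
      using this
  refine le_of_tendsto_of_tendsto tL tR ?_
  filter_upwards [(hs.eventually (hle.and (h3.and h4))).filter_mono nhdsWithin_le_nhds,
    self_mem_nhdsWithin] with ε ⟨hε, h3ε, h4ε⟩ hne
  have hne : ε ≠ 0 := hne
  have hu0 : u ≠ 0 := by rintro rfl; simp at hu
  have hne' : (ε : ℂ) * u ≠ 0 := mul_ne_zero (Complex.ofReal_ne_zero.2 hne) hu0
  replace h3ε := h3ε hne'
  replace h4ε := h4ε hne'
  have hpos : 0 < ε ^ 2 := by positivity
  -- All pairings of a base vector with a varying term vanish, so only `⟪a, a'⟫` and the pairing of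
  -- the two variations survive.
  have eP : ⟪a + ((ε : ℂ) * u) • b + ((ε : ℂ) * u) ^ 2 • ζ (ε * u),
      a' + ((ε : ℂ) * u) • b' + ((ε : ℂ) * u) ^ 2 • η (ε * u)⟫_ℂ = c + ((ε ^ 2 : ℝ) : ℂ) * P ε := by
    have h1' : ⟪b, a'⟫_ℂ = 0 := inner_eq_zero_symm.1 h1
    have h3' : ⟪ζ (ε * u), a'⟫_ℂ = 0 := inner_eq_zero_symm.1 h3ε
    simp only [hP, inner_add_left, inner_add_right, inner_smul_left, inner_smul_right, h1', h2, h3',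
      h4ε, ← hc, map_mul, map_pow, Complex.conj_ofReal]
    push_cast; ring
  have esq := mul_self_le_mul_self (by positivity) hε
  have nP : ‖c + ((ε ^ 2 : ℝ) : ℂ) * P ε‖ ^ 2
      = ‖c‖ ^ 2 + ε ^ 2 * (2 * (conj c * P ε).re + ε ^ 2 * ‖P ε‖ ^ 2) := by
    simp only [← Complex.normSq_eq_norm_sq, Complex.normSq_apply, Complex.add_re, Complex.add_im,
      Complex.mul_re, Complex.mul_im, Complex.conj_re, Complex.conj_im, Complex.ofReal_re,
      Complex.ofReal_im]
    ring
  have nZ := norm_sq_expansion (z := ζ (ε * u)) hab ε u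
  have nW := norm_sq_expansion (z := η (ε * u)) hab' ε u
  rw [eP] at esq
  have esq2 : ‖c + ((ε ^ 2 : ℝ) : ℂ) * P ε‖ ^ 2 * (‖a‖ ^ 2 * ‖a'‖ ^ 2) ≤
      ‖c‖ ^ 2 * ((‖a‖ ^ 2 + ε ^ 2 * N ε) * (‖a'‖ ^ 2 + ε ^ 2 * N' ε)) := by
    rw [← nZ, ← nW]; linarith
  rw [nP] at esq2
  refine le_of_mul_le_mul_left ?_ hpos
  linarith

/-- On each real line through `0` the squared norm has a local minimum, so the real part of `u * ⟪Z
0, deriv Z 0⟫` is zero for every complex `u`; `u = 1` and `u = i` give both parts. -/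
lemma inner_deriv_eq_zero_of_norm_le {Z : ℂ → E} (hZ : DifferentiableAt ℂ Z 0)
    (hmin : ∀ᶠ s in 𝓝 (0 : ℂ), ‖Z 0‖ ≤ ‖Z s‖) : ⟪Z 0, deriv Z 0⟫_ℂ = 0 := by
  have key : ∀ u : ℂ, (u * ⟪Z 0, deriv Z 0⟫_ℂ).re = 0 := by
    intro u
    have h1 : HasDerivAt (fun ε : ℝ => (ε : ℂ) * u) u 0 := by
      simpa using (Complex.ofRealCLM.hasDerivAt (x := (0 : ℝ))).mul_const u
    have h2 : HasDerivAt (fun ε : ℝ => Z ((ε : ℂ) * u)) (u • deriv Z 0) 0 :=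
      HasDerivAt.scomp (h := fun ε : ℝ => (ε : ℂ) * u) (0 : ℝ)
        (by rw [Complex.ofReal_zero, zero_mul]; exact hZ.hasDerivAt) h1
    let _ : InnerProductSpace ℝ E := InnerProductSpace.complexToReal
    have h3 := HasDerivAt.norm_sq (F := E) h2
    have hs : Tendsto (fun ε : ℝ => (ε : ℂ) * u) (𝓝 0) (𝓝 0) := by
      simpa using h1.continuousAt.tendsto
    have h4 : IsLocalMin (fun ε : ℝ => ‖Z ((ε : ℂ) * u)‖ ^ 2) 0 := by
      filter_upwards [hs.eventually hmin] with ε hε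
      simp only [Complex.ofReal_zero, zero_mul]
      gcongr
    have h5 := h4.hasDerivAt_eq_zero h3
    rw [real_inner_eq_re_inner ℂ, inner_smul_right] at h5
    simpa using h5
  apply Complex.ext
  · simpa using key 1
  · simpa using key Complex.I

lemma inner_deriv_eq_zero_of_eventually_const {Z : ℂ → E} (hZ : DifferentiableAt ℂ Z 0) {v : E}
    {c : ℂ} (h : ∀ᶠ s in 𝓝 (0 : ℂ), ⟪v, Z s⟫_ℂ = c) : ⟪v, deriv Z 0⟫_ℂ = 0 := by
  have h1 : HasDerivAt (fun s => innerSL ℂ v (Z s)) (innerSL ℂ v (deriv Z 0)) 0 :=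
    (innerSL ℂ v).hasFDerivAt.comp_hasDerivAt 0 hZ.hasDerivAt
  have h2 : HasDerivAt (fun s => innerSL ℂ v (Z s)) 0 0 :=
    (hasDerivAt_const (0 : ℂ) c).congr_of_eventuallyEq h
  simpa using h1.unique h2

/-- Second variation of the angle between two holomorphic curves with normalised lifts. -/
lemma second_variation_le {Z W : ℂ → E} (hZ : AnalyticAt ℂ Z 0) (hW : AnalyticAt ℂ W 0)
    (hZc : ∀ᶠ s in 𝓝 (0 : ℂ), ⟪W 0, Z s⟫_ℂ = ⟪W 0, Z 0⟫_ℂ)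
    (hWc : ∀ᶠ t in 𝓝 (0 : ℂ), ⟪Z 0, W t⟫_ℂ = ⟪Z 0, W 0⟫_ℂ)
    (hZo : ⟪Z 0, deriv Z 0⟫_ℂ = 0) (hWo : ⟪W 0, deriv W 0⟫_ℂ = 0)
    (hle : ∀ᶠ s in 𝓝 (0 : ℂ), ‖⟪Z s, W s⟫_ℂ‖ * (‖Z 0‖ * ‖W 0‖)
        ≤ ‖⟪Z 0, W 0⟫_ℂ‖ * (‖Z s‖ * ‖W s‖)) :
    2 * (conj ⟪Z 0, W 0⟫_ℂ * ⟪deriv Z 0, deriv W 0⟫_ℂ).re * (‖Z 0‖ ^ 2 * ‖W 0‖ ^ 2)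
      ≤ ‖⟪Z 0, W 0⟫_ℂ‖ ^ 2 *
        (‖deriv Z 0‖ ^ 2 * ‖W 0‖ ^ 2 + ‖deriv W 0‖ ^ 2 * ‖Z 0‖ ^ 2) := by
  obtain ⟨ζ, hζ, eZ⟩ := hZ.exists_eq_add_smul_add_sq_smul
  obtain ⟨η, hη, eW⟩ := hW.exists_eq_add_smul_add_sq_smul
  have o1 := inner_deriv_eq_zero_of_eventually_const hZ.differentiableAt hZc
  have o2 := inner_deriv_eq_zero_of_eventually_const hW.differentiableAt hWc
  have h3 : ∀ᶠ s in 𝓝 (0 : ℂ), s ≠ 0 → ⟪W 0, ζ s⟫_ℂ = 0 := by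
    filter_upwards [hZc] with s hs hne
    rw [eZ s, inner_add_right, inner_add_right, inner_smul_right, inner_smul_right, o1] at hs
    simpa [hne] using hs
  have h4 : ∀ᶠ s in 𝓝 (0 : ℂ), s ≠ 0 → ⟪Z 0, η s⟫_ℂ = 0 := by
    filter_upwards [hWc] with s hs hne
    rw [eW s, inner_add_right, inner_add_right, inner_smul_right, inner_smul_right, o2] at hs
    simpa [hne] using hs
  have key := fun u hu => two_mul_re_le_of_eventually hζ.continuousAt hη.continuousAt hZo hWo
    rfl rfl u hu o1 o2 h3 h4 (by
      filter_upwards [hle] with s hs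
      rwa [← eZ s, ← eW s])
  -- The accelerations enter through `u ^ 2`, which is `1` and `-1` for these two directions, so
  -- they cancel in the sum.
  have k1 := key 1 (by simp)
  have k2 := key Complex.I (by simp)
  simp only [one_pow, one_mul, Complex.I_sq, neg_mul, Complex.neg_re] at k1 k2
  linarith

/-- A curve can be rescaled so that its pairing with a fixed vector is constant. -/
lemma exists_normalised_lift {Z : ℂ → E} (hZ : AnalyticAt ℂ Z 0) {v : E} (hv : ⟪v, Z 0⟫_ℂ ≠ 0) :
    ∃ Y : ℂ → E, AnalyticAt ℂ Y 0 ∧ Y 0 = Z 0 ∧ (∀ᶠ s in 𝓝 (0 : ℂ), ⟪v, Y s⟫_ℂ = ⟪v, Z 0⟫_ℂ) ∧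
      (∀ s, ∃ k : ℂ, Y s = k • Z s) ∧ ∃ k : ℂ, deriv Y 0 = deriv Z 0 + k • Z 0 := by
  have h1 : AnalyticAt ℂ (fun s => ⟪v, Z s⟫_ℂ) 0 := ((innerSL ℂ v).analyticAt _).comp hZ
  have h2 : AnalyticAt ℂ (fun s => ⟪v, Z 0⟫_ℂ / ⟪v, Z s⟫_ℂ) 0 := analyticAt_const.div h1 hv
  refine ⟨fun s => (⟪v, Z 0⟫_ℂ / ⟪v, Z s⟫_ℂ) • Z s, h2.smul hZ, by simp [hv], ?_,
    fun s => ⟨_, rfl⟩, deriv (fun s => ⟪v, Z 0⟫_ℂ / ⟪v, Z s⟫_ℂ) 0, ?_⟩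
  · filter_upwards [h1.continuousAt.eventually_ne hv] with s hs
    rw [inner_smul_right, div_mul_cancel₀ _ hs]
  · rw [deriv_fun_smul h2.differentiableAt hZ.differentiableAt, div_self hv, one_smul]

/-- The orthogonal complement of a plane in dimension three is a line. This is where the dimension
of the projective plane enters. -/
lemma exists_smul_eq_of_orthogonal [FiniteDimensional ℂ E] (hE : Module.finrank ℂ E = 3)
    {a a' b b' : E} (hli : LinearIndependent ℂ ![a, a']) (hb : b ≠ 0)
    (h1 : ⟪a, b⟫_ℂ = 0) (h2 : ⟪a', b⟫_ℂ = 0) (h3 : ⟪a, b'⟫_ℂ = 0) (h4 : ⟪a', b'⟫_ℂ = 0) :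
    ∃ k : ℂ, k • b = b' := by
  set S := Submodule.span ℂ (Set.range ![a, a']) with hS
  have hS2 : Module.finrank ℂ S = 2 := by simpa using finrank_span_eq_card hli
  have hadd := Submodule.finrank_add_finrank_orthogonal S
  have hmem : ∀ x : E, ⟪a, x⟫_ℂ = 0 → ⟪a', x⟫_ℂ = 0 → x ∈ Sᗮ := by
    intro x hx hx'
    rw [Submodule.mem_orthogonal]
    intro y hy
    induction hy using Submodule.span_induction with
    | mem y hy =>
      obtain ⟨i, rfl⟩ := hy
      fin_cases i
      · exact hx
      · exact hx'
    | zero => simp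
    | add y z _ _ hy hz => rw [inner_add_left, hy, hz, add_zero]
    | smul k y _ hy => rw [inner_smul_left, hy, mul_zero]
  have h1' : Module.finrank ℂ Sᗮ = 1 := by omega
  obtain ⟨k, hk⟩ := exists_smul_eq_of_finrank_eq_one h1' (x := (⟨b, hmem b h1 h2⟩ : Sᗮ))
    (by simpa [Subtype.ext_iff] using hb) ⟨b', hmem b' h3 h4⟩
  exact ⟨k, congrArg Subtype.val hk⟩

end LocalAngle

/-! ### Two curves that locally minimise their distance at the base points must meet there. -/

section FrankelPrinciple

variable {E : Type*} [NormedAddCommGroup E] [InnerProductSpace ℂ E]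

/-- If all nearby points of two immersed holomorphic curves in the projective plane are at least
as far apart as their base points, then the base points coincide. -/
theorem norm_mul_norm_le_norm_inner_of_eventually_le [FiniteDimensional ℂ E]
    (hE : Module.finrank ℂ E = 3) {Z W : ℂ → E} (hZ : AnalyticAt ℂ Z 0) (hW : AnalyticAt ℂ W 0)
    (hZ0 : Z 0 ≠ 0) (hW0 : W 0 ≠ 0)
    (hZi : ∀ k : ℂ, deriv Z 0 ≠ k • Z 0) (hWi : ∀ k : ℂ, deriv W 0 ≠ k • W 0)
    (hle : ∀ᶠ x : ℂ × ℂ in 𝓝 0 ×ˢ 𝓝 0, ‖⟪Z x.1, W x.2⟫_ℂ‖ * (‖Z 0‖ * ‖W 0‖)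
        ≤ ‖⟪Z 0, W 0⟫_ℂ‖ * (‖Z x.1‖ * ‖W x.2‖)) :
    ‖Z 0‖ * ‖W 0‖ ≤ ‖⟪Z 0, W 0⟫_ℂ‖ := by
  have hA : 0 < ‖Z 0‖ := norm_pos_iff.2 hZ0
  have hB : 0 < ‖W 0‖ := norm_pos_iff.2 hW0
  by_cases hc : ⟪Z 0, W 0⟫_ℂ = 0
  -- Points at the largest possible distance: the pairing then vanishes identically near the base
  -- points. Differentiating in each variable makes the plane of `Z 0`, `deriv Z 0` orthogonal to
  -- that of `W 0`, `deriv W 0`, impossible in dimension three.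
  · exfalso
    have h0 : ∀ᶠ x : ℂ × ℂ in 𝓝 0 ×ˢ 𝓝 0, ⟪Z x.1, W x.2⟫_ℂ = 0 := by
      filter_upwards [hle] with x hx
      rw [hc, norm_zero, zero_mul] at hx
      exact norm_le_zero_iff.1 (nonpos_of_mul_nonpos_left hx (by positivity))
    have h1 : ∀ᶠ s in 𝓝 (0 : ℂ), ⟪W 0, Z s⟫_ℂ = 0 ∧ ⟪deriv W 0, Z s⟫_ℂ = 0 := by
      filter_upwards [h0.curry] with s hs
      exact ⟨inner_eq_zero_symm.1 hs.self_of_nhds, inner_eq_zero_symm.1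
        (inner_deriv_eq_zero_of_eventually_const hW.differentiableAt hs)⟩
    have h2 := h1.self_of_nhds
    have h3 := inner_deriv_eq_zero_of_eventually_const hZ.differentiableAt (h1.mono fun _ h => h.1)
    have h4 := inner_deriv_eq_zero_of_eventually_const hZ.differentiableAt (h1.mono fun _ h => h.2)
    obtain ⟨k, hk⟩ := exists_smul_eq_of_orthogonal hE
      ((LinearIndependent.pair_iff' hZ0).2 fun k h => hZi k h.symm) hW0
      hc (inner_eq_zero_symm.1 h3) (inner_eq_zero_symm.1 h2.2) (inner_eq_zero_symm.1 h4)
    exact hWi k hk.symm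
  by_contra! hlt
  -- Proportional vectors would give equality in Cauchy–Schwarz, against `hlt`.
  have hli : LinearIndependent ℂ ![Z 0, W 0] := by
    rw [LinearIndependent.pair_iff' hZ0]
    intro k hk
    rw [← hk, inner_smul_right, norm_mul, norm_smul, inner_self_eq_norm_sq_to_K] at hlt
    simp only [Complex.coe_algebraMap, norm_pow, Complex.norm_real, norm_norm] at hlt
    exact absurd hlt (by rw [not_lt]; apply le_of_eq; ring)
  have hc' : ⟪W 0, Z 0⟫_ℂ ≠ 0 := fun h => hc (inner_eq_zero_symm.1 h)
  obtain ⟨Y, hY, hY0, hYc, hYs, kY, hYd⟩ := exists_normalised_lift hZ hc'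
  obtain ⟨V, hV, hV0, hVc, hVs, kV, hVd⟩ := exists_normalised_lift hW hc
  have hle' : ∀ᶠ x : ℂ × ℂ in 𝓝 0 ×ˢ 𝓝 0, ‖⟪Y x.1, V x.2⟫_ℂ‖ * (‖Y 0‖ * ‖V 0‖)
        ≤ ‖⟪Y 0, V 0⟫_ℂ‖ * (‖Y x.1‖ * ‖V x.2‖) := by
    filter_upwards [hle] with x hx
    obtain ⟨k, hk⟩ := hYs x.1
    obtain ⟨l, hl⟩ := hVs x.2
    rw [hY0, hV0, hk, hl, inner_smul_left, inner_smul_right, norm_mul, norm_mul, norm_smul,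
      norm_smul, RCLike.norm_conj]
    have := mul_le_mul_of_nonneg_left hx (by positivity : 0 ≤ ‖k‖ * ‖l‖)
    linarith
  have hcpos : 0 < ‖⟪Z 0, W 0⟫_ℂ‖ := norm_pos_iff.2 hc
  -- With the second curve frozen at its base point the pairing is constant, so the inequality says
  -- that the norm of `Y` is smallest at `0`.
  have hYo : ⟪Y 0, deriv Y 0⟫_ℂ = 0 := by
    refine inner_deriv_eq_zero_of_norm_le hY.differentiableAt ?_
    filter_upwards [hle'.curry, hYc] with s hs hs'
    have h := hs.self_of_nhds
    rw [hV0, norm_inner_symm, hs', hY0, norm_inner_symm] at h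
    rw [hY0]
    have h' := le_of_mul_le_mul_left h hcpos
    exact le_of_mul_le_mul_right h' hB
  have hVo : ⟪V 0, deriv V 0⟫_ℂ = 0 := by
    refine inner_deriv_eq_zero_of_norm_le hV.differentiableAt ?_
    have hsw : Tendsto (fun t : ℂ => ((0 : ℂ), t)) (𝓝 0) (𝓝 0 ×ˢ 𝓝 0) :=
      tendsto_const_nhds.prodMk tendsto_id
    filter_upwards [hsw.eventually hle', hVc] with s h hs'
    rw [hV0, hY0, hs'] at h
    rw [hV0]
    have h' := le_of_mul_le_mul_left h hcpos
    exact le_of_mul_le_mul_left h' hA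
  have hYW := inner_deriv_eq_zero_of_eventually_const hY.differentiableAt hYc
  have hVZ := inner_deriv_eq_zero_of_eventually_const hV.differentiableAt hVc
  have hb : deriv Y 0 ≠ 0 := by
    intro h
    refine hZi (-kY) ?_
    rw [neg_smul, eq_neg_iff_add_eq_zero, ← hYd, h]
  have hb' : deriv V 0 ≠ 0 := by
    intro h
    refine hWi (-kV) ?_
    rw [neg_smul, eq_neg_iff_add_eq_zero, ← hVd, h]
  obtain ⟨ν, hν⟩ := exists_smul_eq_of_orthogonal hE hli hb (by rwa [← hY0]) hYW hVZ
    (by rwa [← hV0])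
  have hν0 : ν ≠ 0 := by
    rintro rfl
    exact hb' (by rw [← hν, zero_smul])
  set c := ⟪Z 0, W 0⟫_ℂ with hcdef
  -- The phase of `μ` makes `conj c * μ` positive; its modulus `‖W 0‖ / ‖Z 0‖` makes the two terms
  -- on the right of `second_variation_le` equal. The parameter of `V` is rescaled to give velocity
  -- `μ • deriv Y 0`.
  set μ : ℂ := ((‖W 0‖ / ‖Z 0‖ / ‖c‖ : ℝ) : ℂ) * c with hμ
  set U : ℂ → E := fun t => V (μ / ν * t) with hU
  have hU0 : U 0 = W 0 := by simp [hU, hV0]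
  have hlin : Tendsto (fun t : ℂ => μ / ν * t) (𝓝 0) (𝓝 0) := by
    simpa using (continuous_const_mul (μ / ν)).tendsto 0
  have hUd : deriv U 0 = μ • deriv Y 0 := by
    rw [hU, deriv_comp_mul_left, mul_zero, ← hν, smul_smul, div_mul_cancel₀ _ hν0]
  have hUa : AnalyticAt ℂ U 0 := by
    refine AnalyticAt.comp (g := V) (f := fun t : ℂ => μ / ν * t) (by simpa using hV) ?_
    exact analyticAt_const.mul analyticAt_id
  have hUo : ⟪U 0, deriv U 0⟫_ℂ = 0 := by
    rw [hU0, hUd, inner_smul_right, hYW, mul_zero]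
  have key := second_variation_le hY hUa (by rwa [hU0, hY0])
    (by rw [hU0, hY0]; exact hlin.eventually hVc) hYo hUo (by
      have ht : Tendsto (fun s : ℂ => (s, μ / ν * s)) (𝓝 0) (𝓝 0 ×ˢ 𝓝 0) :=
        tendsto_id.prodMk hlin
      filter_upwards [ht.eventually hle'] with s hs
      rw [hU0, ← hV0]
      exact hs)
  have hβ : 0 < ‖deriv Y 0‖ := norm_pos_iff.2 hb
  have nμ : ‖μ‖ = ‖W 0‖ / ‖Z 0‖ := by
    rw [hμ, norm_mul, Complex.norm_real, Real.norm_of_nonneg (by positivity),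
      div_mul_cancel₀ _ hcpos.ne']
  have hre : (conj c * ⟪deriv Y 0, μ • deriv Y 0⟫_ℂ).re
      = ‖W 0‖ / ‖Z 0‖ * ‖c‖ * ‖deriv Y 0‖ ^ 2 := by
    have : conj c * ⟪deriv Y 0, μ • deriv Y 0⟫_ℂ
        = ((‖W 0‖ / ‖Z 0‖ * ‖c‖ * ‖deriv Y 0‖ ^ 2 : ℝ) : ℂ) := by
      have hcc : conj c * c = ((‖c‖ ^ 2 : ℝ) : ℂ) := by
        rw [← Complex.normSq_eq_conj_mul_self, Complex.normSq_eq_norm_sq]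
      have hc0 : (‖c‖ : ℂ) ≠ 0 := Complex.ofReal_ne_zero.2 hcpos.ne'
      rw [inner_smul_right, inner_self_eq_norm_sq_to_K, hμ]
      calc _ = ((‖W 0‖ / ‖Z 0‖ / ‖c‖ : ℝ) : ℂ) * (conj c * c) * (‖deriv Y 0‖ : ℂ) ^ 2 := by
            simp only [Complex.coe_algebraMap]; ring
        _ = _ := by
            rw [hcc]; push_cast; field_simp
    rw [this, Complex.ofReal_re]
  rw [hU0, hY0, hUd, hre, norm_smul, nμ] at key
  have e1 : 2 * (‖W 0‖ / ‖Z 0‖ * ‖c‖ * ‖deriv Y 0‖ ^ 2) * (‖Z 0‖ ^ 2 * ‖W 0‖ ^ 2)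
      = (2 * ‖c‖ * ‖deriv Y 0‖ ^ 2 * ‖W 0‖ ^ 2) * (‖Z 0‖ * ‖W 0‖) := by
    field_simp
  have e2 : ‖c‖ ^ 2 * (‖deriv Y 0‖ ^ 2 * ‖W 0‖ ^ 2 +
      (‖W 0‖ / ‖Z 0‖ * ‖deriv Y 0‖) ^ 2 * ‖Z 0‖ ^ 2)
      = (2 * ‖c‖ * ‖deriv Y 0‖ ^ 2 * ‖W 0‖ ^ 2) * ‖c‖ := by
    field_simp; ring
  rw [e1, e2] at key
  exact absurd (le_of_mul_le_mul_left key (by positivity)) (not_le.2 hlt)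

end FrankelPrinciple

/-! ### The Fubini–Study distance and the topology of the projective plane. -/

namespace CP2

/-- The cosine of the Fubini–Study distance. -/
noncomputable def cosDist (p q : CP2) : ℝ :=
  ‖⟪WithLp.toLp 2 p.rep, WithLp.toLp 2 q.rep⟫_ℂ‖ /
    (‖WithLp.toLp 2 p.rep‖ * ‖WithLp.toLp 2 q.rep‖)

/-- The ratio is unchanged when either vector is rescaled, so the arbitrary choice `rep` can be
traded for any lift, in particular a holomorphic one. -/
lemma cosDist_mk (v w : EuclideanSpace ℂ (Fin 3)) (hv : v.ofLp ≠ 0) (hw : w.ofLp ≠ 0) :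
    cosDist (Projectivization.mk ℂ v.ofLp hv) (Projectivization.mk ℂ w.ofLp hw)
      = ‖⟪v, w⟫_ℂ‖ / (‖v‖ * ‖w‖) := by
  obtain ⟨a, ha⟩ := Projectivization.exists_smul_eq_mk_rep ℂ v.ofLp hv
  obtain ⟨b, hb⟩ := Projectivization.exists_smul_eq_mk_rep ℂ w.ofLp hw
  have hv' : ‖v‖ ≠ 0 := by
    rw [norm_ne_zero_iff]; rintro rfl; exact hv rfl
  have hw' : ‖w‖ ≠ 0 := by
    rw [norm_ne_zero_iff]; rintro rfl; exact hw rfl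
  have ha0 : ‖(a : ℂ)‖ ≠ 0 := norm_ne_zero_iff.2 a.ne_zero
  have hb0 : ‖(b : ℂ)‖ ≠ 0 := norm_ne_zero_iff.2 b.ne_zero
  have ea : WithLp.toLp 2 (Projectivization.mk ℂ v.ofLp hv).rep = (a : ℂ) • v := by
    rw [← ha]; rfl
  have eb : WithLp.toLp 2 (Projectivization.mk ℂ w.ofLp hw).rep = (b : ℂ) • w := by
    rw [← hb]; rfl
  rw [cosDist, ea, eb, inner_smul_left, inner_smul_right, norm_mul, norm_mul, norm_smul, norm_smul,
    RCLike.norm_conj]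
  field_simp

lemma toLp_rep_ne_zero (p : CP2) : WithLp.toLp 2 p.rep ≠ (0 : EuclideanSpace ℂ (Fin 3)) :=
  fun h => p.rep_nonzero (by simpa using h)

lemma cosDist_self (p : CP2) : cosDist p p = 1 := by
  have h := norm_ne_zero_iff.2 (toLp_rep_ne_zero p)
  rw [cosDist, inner_self_eq_norm_sq_to_K]
  simp only [Complex.coe_algebraMap, norm_pow, Complex.norm_real, norm_norm]
  field_simp

lemma eq_of_one_le_cosDist {p q : CP2} (h : 1 ≤ cosDist p q) : p = q := by
  have hp := toLp_rep_ne_zero p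
  have hq := toLp_rep_ne_zero q
  have hp' := norm_pos_iff.2 hp
  have hq' := norm_pos_iff.2 hq
  rw [cosDist, one_le_div (by positivity)] at h
  obtain ⟨r, hr, e⟩ := (norm_inner_eq_norm_iff (𝕜 := ℂ) hp hq).1
    (le_antisymm (norm_inner_le_norm _ _) h)
  rw [← p.mk_rep, ← q.mk_rep, eq_comm, Projectivization.mk_eq_mk_iff']
  exact ⟨r, by simpa using (congrArg WithLp.ofLp e).symm⟩

lemma continuous_cosDist_left (q : CP2) : Continuous fun p => cosDist p q := by
  refine continuous_coinduced_dom.2 ?_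
  have : (fun p => cosDist p q) ∘ (Projectivization.mk' ℂ : {v : Fin 3 → ℂ // v ≠ 0} → CP2)
      = fun v => ‖⟪WithLp.toLp 2 v.1, WithLp.toLp 2 q.rep⟫_ℂ‖ /
        (‖WithLp.toLp 2 v.1‖ * ‖WithLp.toLp 2 q.rep‖) := by
    funext v
    conv_lhs => rw [← q.mk_rep]
    exact cosDist_mk (WithLp.toLp 2 v.1) (WithLp.toLp 2 q.rep) v.2 q.rep_nonzero
  rw [this]
  have hc : Continuous fun v : {v : Fin 3 → ℂ // v ≠ 0} =>
      (WithLp.toLp 2 v.1 : EuclideanSpace ℂ (Fin 3)) :=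
    (PiLp.continuous_toLp 2 _).comp continuous_subtype_val
  refine (hc.inner continuous_const).norm.div (hc.norm.mul continuous_const) fun v => ?_
  refine mul_ne_zero (norm_ne_zero_iff.2 fun h => v.2 (by simpa using h))
    (norm_ne_zero_iff.2 (toLp_rep_ne_zero q))

/-- The function `cosDist · q` is continuous and takes the value `1` at `q`; equality in
Cauchy–Schwarz shows that it does so nowhere else. -/
instance : T2Space CP2 := by
  refine ⟨fun p q hpq => ?_⟩
  refine separated_by_continuous (continuous_cosDist_left q) fun h => hpq ?_
  exact eq_of_one_le_cosDist (h.trans (cosDist_self q)).ge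

lemma ofLp_ne_zero_of_mem_sphere (x : Metric.sphere (0 : EuclideanSpace ℂ (Fin 3)) 1) :
    x.1.ofLp ≠ 0 := by
  intro h
  have hx : ‖x.1‖ = 1 := mem_sphere_zero_iff_norm.1 x.2
  rw [show x.1 = 0 by ext i; exact congrFun h i, norm_zero] at hx
  exact zero_ne_one hx

/-- The Hopf map. -/
noncomputable def ofSphere (x : Metric.sphere (0 : EuclideanSpace ℂ (Fin 3)) 1) : CP2 :=
  Projectivization.mk ℂ x.1.ofLp (ofLp_ne_zero_of_mem_sphere x)

lemma continuous_ofSphere : Continuous ofSphere :=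
  continuous_mk'.comp (((PiLp.continuous_ofLp 2 _).comp continuous_subtype_val).subtype_mk
    ofLp_ne_zero_of_mem_sphere)

lemma surjective_ofSphere : Function.Surjective ofSphere := by
  intro p
  have hp := norm_ne_zero_iff.2 (toLp_rep_ne_zero p)
  refine ⟨⟨((‖WithLp.toLp 2 p.rep‖⁻¹ : ℝ) : ℂ) • WithLp.toLp 2 p.rep, ?_⟩, ?_⟩
  · rw [mem_sphere_zero_iff_norm, norm_smul, Complex.norm_real, norm_inv, norm_norm,
      inv_mul_cancel₀ hp]
  · conv_rhs => rw [← p.mk_rep]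
    rw [ofSphere, Projectivization.mk_eq_mk_iff']
    exact ⟨_, rfl⟩

lemma cosDist_ofSphere (x y : Metric.sphere (0 : EuclideanSpace ℂ (Fin 3)) 1) :
    cosDist (ofSphere x) (ofSphere y) = ‖⟪x.1, y.1⟫_ℂ‖ := by
  rw [ofSphere, ofSphere, cosDist_mk, mem_sphere_zero_iff_norm.1 x.2,
    mem_sphere_zero_iff_norm.1 y.2]
  simp

/-- The distance between two nonempty compact sets is attained. -/
lemma exists_cosDist_max {S T : Set CP2} (hS : IsCompact S) (hT : IsCompact T)
    (hS' : S.Nonempty) (hT' : T.Nonempty) :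
    ∃ p ∈ S, ∃ q ∈ T, ∀ p' ∈ S, ∀ q' ∈ T, cosDist p' q' ≤ cosDist p q := by
  -- On the unit sphere, which is compact, `cosDist` lifts to the norm of the inner product, visibly
  -- continuous in both variables together.
  have hcS := (hS.isClosed.preimage continuous_ofSphere).isCompact
  have hcT := (hT.isClosed.preimage continuous_ofSphere).isCompact
  have hne := (hS'.preimage surjective_ofSphere).prod (hT'.preimage surjective_ofSphere)
  obtain ⟨⟨x, y⟩, hxy, hmax⟩ := (hcS.prod hcT).exists_isMaxOn hne
    (f := fun z => ‖⟪z.1.1, z.2.1⟫_ℂ‖) (by fun_prop)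
  refine ⟨_, hxy.1, _, hxy.2, fun p' hp' q' hq' => ?_⟩
  obtain ⟨x', rfl⟩ := surjective_ofSphere p'
  obtain ⟨y', rfl⟩ := surjective_ofSphere q'
  rw [cosDist_ofSphere, cosDist_ofSphere]
  exact hmax (show (x', y') ∈ _ from ⟨hp', hq'⟩)

/-- Both directions are needed: the second provides a differentiable inverse of the first, whose
derivative is therefore injective. -/
lemma contDiffOn_affineCoord_symm (i : Fin 3) {e : OpenPartialHomeomorph CP2 (ℂ × ℂ)}
    (he : e ∈ IsManifold.maximalAtlas 𝓘(ℂ, ℂ × ℂ) ω CP2) :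
    ContDiffOn ℂ ω (fun y => affineCoord i (e.symm y)) (e.symm.trans (affineChart i)).source ∧
    ContDiffOn ℂ ω (fun x => e (affineParam i x)) ((affineChart i).symm.trans e).source := by
  have hi : affineChart i ∈ IsManifold.maximalAtlas 𝓘(ℂ, ℂ × ℂ) ω CP2 :=
    IsManifold.subset_maximalAtlas ⟨i, rfl⟩
  exact ⟨contMDiffOn_iff_contDiffOn.1 (contMDiffOn_of_mem_contDiffGroupoid
      (IsManifold.compatible_of_mem_maximalAtlas he hi)),
    contMDiffOn_iff_contDiffOn.1 (contMDiffOn_of_mem_contDiffGroupoid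
      (IsManifold.compatible_of_mem_maximalAtlas hi he))⟩

end CP2

/-! ### Minimal sets and holomorphic discs in leaves. -/

namespace SHFC

section

variable {M : Type*} [TopologicalSpace M] [ChartedSpace (ℂ × ℂ) M] (F : SHFC M)

lemma exists_isFlowBox_of_notMem_sing {p : M} (hp : p ∉ F.sing) :
    ∃ e, F.IsFlowBox e ∧ p ∈ e.source := by
  by_cases hE : p ∈ F.E
  · by_contra h
    exact hp ⟨hE, fun hr => h hr.2⟩
  · obtain ⟨e, he, hpe⟩ := F.cover p hE
    exact ⟨e, ⟨F.polydisc e he, fun e' he' => ⟨F.compatible e he e' he', F.compatible e' he' e he⟩⟩,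
      hpe⟩

lemma leaf_of_mem_sing {p : M} (hp : p ∈ F.sing) : F.leaf p ⊆ {p} := by
  intro q hq
  induction hq with
  | refl => rfl
  | tail _ h ih =>
    obtain rfl := ih
    obtain ⟨P, ⟨e, he, w, -, rfl⟩, hx, -⟩ := h
    exact absurd ⟨hp.1, e, he, hx.1⟩ hp.2

/-- A singular point is by itself compact and saturated, so a minimal set containing it reduces to
it. -/
lemma IsNontrivialMinimalSet.notMem_sing {S : Set M} {F : SHFC M} (hS : F.IsNontrivialMinimalSet S)
    {p : M} (hp : p ∈ S) : p ∉ F.sing := by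
  intro hps
  have hsub : ({p} : Set M) ⊆ S := Set.singleton_subset_iff.2 hp
  refine hS.2 p hps (Set.Subset.antisymm (hS.1.2 ⟨isCompact_singleton, ?_, p, rfl⟩ hsub) hsub)
  rintro q rfl
  exact F.leaf_of_mem_sing hps

lemma IsMinimalSet.eq_of_inter_nonempty [T2Space M] {F : SHFC M} {S T : Set M}
    (hS : F.IsMinimalSet S) (hT : F.IsMinimalSet T) (h : (S ∩ T).Nonempty) : S = T := by
  have hST : IsCompact (S ∩ T) ∧ F.IsSaturated (S ∩ T) ∧ (S ∩ T).Nonempty :=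
    ⟨hS.1.1.inter hT.1.1,
      fun p hp => Set.subset_inter (hS.1.2.1 p hp.1) (hT.1.2.1 p hp.2), h⟩
  exact Set.Subset.antisymm ((hS.2 hST Set.inter_subset_left).trans Set.inter_subset_right)
    ((hT.2 hST Set.inter_subset_right).trans Set.inter_subset_left)

end

/-- The leaf through a nonsingular point of the projective plane contains an immersed holomorphic
curve through that point. -/
lemma exists_analyticAt_lift_leaf (F : SHFC CP2) {p : CP2} (hp : p ∉ F.sing) :
    ∃ (Z : ℂ → EuclideanSpace ℂ (Fin 3)) (hne : ∀ s, (Z s).ofLp ≠ 0), AnalyticAt ℂ Z 0 ∧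
      (∀ k : ℂ, deriv Z 0 ≠ k • Z 0) ∧ Projectivization.mk ℂ (Z 0).ofLp (hne 0) = p ∧
      ∀ᶠ s in 𝓝 0, Projectivization.mk ℂ (Z s).ofLp (hne s) ∈ F.leaf p := by
  obtain ⟨e, he, hpe⟩ := F.exists_isFlowBox_of_notMem_sing hp
  obtain ⟨i, hi⟩ := CP2.exists_mem_affineOpen p
  obtain ⟨hg, hh⟩ := CP2.contDiffOn_affineCoord_symm i he.1.1
  set g : ℂ × ℂ → ℂ × ℂ := fun y => CP2.affineCoord i (e.symm y) with hgdef
  set h : ℂ × ℂ → ℂ × ℂ := fun x => e (CP2.affineParam i x) with hhdef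
  set U := (e.symm.trans (CP2.affineChart i)).source with hUdef
  have hUmem : ∀ y, y ∈ U ↔ y ∈ e.target ∧ e.symm y ∈ CP2.affineOpen i := fun y => by
    rw [hUdef, OpenPartialHomeomorph.trans_source]; rfl
  have hUo : IsOpen U := (e.symm.trans (CP2.affineChart i)).open_source
  have hxU : e p ∈ U := by
    rw [hUmem, e.left_inv hpe]; exact ⟨e.map_source hpe, hi⟩
  have hUn : U ∈ 𝓝 (e p) := hUo.mem_nhds hxU
  have hgy : ∀ y ∈ U, CP2.affineParam i (g y) = e.symm y := fun y hy =>
    CP2.affineParam_affineCoord i _ ((hUmem y).1 hy).2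
  have hhg : ∀ y ∈ U, h (g y) = y := fun y hy => by
    rw [hhdef]; simp only [hgy y hy]; exact e.right_inv ((hUmem y).1 hy).1
  have hgA : ContDiffAt ℂ ω g (e p) := hg.contDiffAt hUn
  have hgp : CP2.affineParam i (g (e p)) = p := by rw [hgy _ hxU, e.left_inv hpe]
  have hhA : ContDiffAt ℂ ω h (g (e p)) := by
    refine hh.contDiffAt (((CP2.affineChart i).symm.trans e).open_source.mem_nhds ?_)
    rw [OpenPartialHomeomorph.trans_source]
    refine ⟨Set.mem_univ _, ?_⟩
    change CP2.affineParam i (g (e p)) ∈ e.source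
    rwa [hgp]
  have hgd : DifferentiableAt ℂ g (e p) := hgA.differentiableAt (by simp)
  have hhd : DifferentiableAt ℂ h (g (e p)) := hhA.differentiableAt (by simp)
  have hdg : fderiv ℂ g (e p) (1, 0) ≠ 0 := by
    intro h0
    have h1 := hhd.hasFDerivAt.comp (e p) hgd.hasFDerivAt
    have h2 : HasFDerivAt (h ∘ g) (ContinuousLinearMap.id ℂ (ℂ × ℂ)) (e p) :=
      (hasFDerivAt_id (e p)).congr_of_eventuallyEq (by filter_upwards [hUn] using hhg)
    have h3 := congrArg (fun L : ℂ × ℂ →L[ℂ] ℂ × ℂ => L (1, 0)) (h1.unique h2)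
    simp [h0, Prod.ext_iff] at h3
  -- The horizontal line through `e p` parametrises the plaque through `p`.
  set ℓ : ℂ → ℂ × ℂ := fun s => e p + s • ((1, 0) : ℂ × ℂ) with hℓ
  have hℓ0 : ℓ 0 = e p := by simp [hℓ]
  have hℓA : AnalyticAt ℂ ℓ 0 :=
    analyticAt_const.add (analyticAt_id.smul analyticAt_const)
  have hℓd : HasDerivAt ℓ (1, 0) 0 := by
    have h1 := ((hasDerivAt_id (0 : ℂ)).smul_const ((1, 0) : ℂ × ℂ)).const_add (e p)
    rwa [one_smul] at h1
  have hgℓ : HasDerivAt (g ∘ ℓ) (fderiv ℂ g (e p) (1, 0)) 0 :=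
    HasFDerivAt.comp_hasDerivAt 0 (by rw [hℓ0]; exact hgd.hasFDerivAt) hℓd
  have hgℓA : AnalyticAt ℂ (g ∘ ℓ) 0 :=
    AnalyticAt.comp (by rw [hℓ0]; exact hgA.analyticAt) hℓA
  set Z : ℂ → EuclideanSpace ℂ (Fin 3) := fun s => WithLp.toLp 2 (CP2.affineVec i (g (ℓ s)))
    with hZdef
  have hZA : AnalyticAt ℂ Z 0 := by
    have h1 : ContDiff ℂ ω (fun z => (WithLp.toLp 2 (CP2.affineVec i z) :
        EuclideanSpace ℂ (Fin 3))) :=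
      (PiLp.continuousLinearEquiv 2 ℂ (fun _ : Fin 3 => ℂ)).symm.contDiff.comp
        (contDiff_pi.2 (CP2.contDiff_affineVec i))
    exact AnalyticAt.comp (f := g ∘ ℓ) h1.contDiffAt.analyticAt hgℓA
  have hZk : ∀ k, HasDerivAt (fun s => Z s k) (deriv Z 0 k) 0 := fun k =>
    (EuclideanSpace.proj k : EuclideanSpace ℂ (Fin 3) →L[ℂ] ℂ).hasFDerivAt.comp_hasDerivAt 0
      hZA.differentiableAt.hasDerivAt
  refine ⟨Z, fun s => CP2.affineVec_ne_zero i _, hZA, ?_, ?_, ?_⟩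
  · intro k hk
    -- The `i`-th entry of `Z` is constantly `1`, so a velocity proportional to `Z 0` must vanish,
    -- against `hdg`.
    have hi0 : deriv Z 0 i = 0 := by
      refine (hZk i).unique ?_
      simpa [hZdef] using hasDerivAt_const (0 : ℂ) (1 : ℂ)
    have hk0 : k = 0 := by
      rw [hk] at hi0
      simpa [hZdef] using hi0
    rw [hk0, zero_smul] at hk
    have h1 := hZk (i.succAbove 0)
    have h2 := hZk (i.succAbove 1)
    rw [hk, PiLp.zero_apply] at h1 h2
    simp only [hZdef, CP2.affineVec_zero, CP2.affineVec_one] at h1 h2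
    exact hdg (hgℓ.unique (h1.prodMk h2))
  · change CP2.affineParam i (g (ℓ 0)) = p
    rw [hℓ0, hgp]
  · have hev : ∀ᶠ s in 𝓝 (0 : ℂ), ℓ s ∈ U :=
      hℓA.continuousAt.eventually_mem (by rwa [hℓ0])
    filter_upwards [hev] with s hs
    change CP2.affineParam i (g (ℓ s)) ∈ _
    rw [hgy _ hs]
    have ht := ((hUmem _).1 hs).1
    refine Relation.ReflTransGen.single ⟨_, ⟨e, he, (e p).2, ⟨e p, e.map_source hpe, rfl⟩, rfl⟩,
      ⟨hpe, rfl⟩, e.map_target ht, ?_⟩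
    rw [e.right_inv ht]
    simp [hℓ]

end SHFC

theorem theorem4p2 (F : SHFC CP2) (M₁ M₂ : Set CP2)
    (h₁ : F.IsNontrivialMinimalSet M₁) (h₂ : F.IsNontrivialMinimalSet M₂) :
    M₁ = M₂ := by
  obtain ⟨p, hp, q, hq, hmax⟩ := CP2.exists_cosDist_max h₁.1.1.1 h₂.1.1.1 h₁.1.1.2.2 h₂.1.1.2.2
  obtain ⟨Z, hZ, hZA, hZi, hZp, hZl⟩ := F.exists_analyticAt_lift_leaf (h₁.notMem_sing hp)
  obtain ⟨W, hW, hWA, hWi, hWq, hWl⟩ := F.exists_analyticAt_lift_leaf (h₂.notMem_sing hq)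
  have hZ0 : ∀ s, Z s ≠ 0 := fun s h => hZ s (by rw [h]; rfl)
  have hW0 : ∀ s, W s ≠ 0 := fun s h => hW s (by rw [h]; rfl)
  have hpos : ∀ s t, 0 < ‖Z s‖ * ‖W t‖ := fun s t =>
    mul_pos (norm_pos_iff.2 (hZ0 s)) (norm_pos_iff.2 (hW0 t))
  have key := norm_mul_norm_le_norm_inner_of_eventually_le (by simp) hZA hWA (hZ0 0) (hW0 0) hZi hWi
    -- Saturation keeps the nearby points of the two discs in `M₁` and `M₂`, where the maximality of
    -- `cosDist p q` applies.
    (by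
      filter_upwards [hZl.prod_mk hWl] with x hx
      have h := hmax _ (h₁.1.1.2.1 p hp hx.1) _ (h₂.1.1.2.1 q hq hx.2)
      rw [← hZp, ← hWq, CP2.cosDist_mk, CP2.cosDist_mk] at h
      exact (div_le_div_iff₀ (hpos _ _) (hpos _ _)).1 h)
  have hpq : p = q := by
    refine CP2.eq_of_one_le_cosDist ?_
    rw [← hZp, ← hWq, CP2.cosDist_mk, one_le_div (hpos _ _)]
    exact key
  exact h₁.1.eq_of_inter_nonempty h₂.1 ⟨p, hp, hpq ▸ hq⟩
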